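/- Let $X$ be an abstract simplicial complex and $x_0$ a vertex of $X$. **Edge group.** A based edge loop of length $m\ge 0$ in $X$ is a sequence $l=(x_0=v_0,v_1,\dots,v_m=x_0)$ of vertices such that each $\{v_i,v_{i+1}\}$ is a simplex of $X$ (repeats allowed). The edge group $E(X,x_0)$ is the set of based edge loops of all lengths modulo the equivalence relation generated by the moves: (i) repeat a vertex, $(\dots,v_i,\dots)\approx(\dots,v_i,v_i,\dots)$; (ii) for $0<i<m$ replace $v_i$ by $v_i'$ when $\{v_{i-1},v_i,v_i'\}$ and $\{v_i,v_i',v_{i+1}\}$ are simplices of $X$. The product is induced by concatenation $(x_0,v_1,\dots,v_{m-1},x_0)\cdot(x_0,v'_1,\dots,v'_{n-1},x_0)=(x_0,v_1,\dots,v_{m-1},x_0,x_0,v'_1,\dots,v'_{n-1},x_0)$, of length $m+n+1$. **Loop complex.** $\Omega X$ is the simplicial complex whose vertices are the based edge loops in $X$ of all lengths $m\ge0$. A nonempty finite set $\sigma$ of such loops is a simplex if there is $m$ such that at least one loop in $\sigma$ has length exactly $m$, all others have length $m$ or $m-1$, and, after each loop of length $m-1$ has been extended to length $m$ by repeating its final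 vertex $x_0$, writing $\sigma_i$ for the set of $i$th vertices of the loops in $\sigma$, each union $\sigma_i\cup\sigma_{i+1}$ $(0\le i\le m-1)$ is a simplex of $X$. Let $\mathbf{x_0^m}$ be the constant loop of length $m$ at $x_0$; the basepoint of $\Omega X$ is $\mathbf{x_0}=\mathbf{x_0^0}$. **Face group.** Let $I_m$ be the simplicial complex with vertices $0,\dots,m$ whose simplices are the vertices and the pairs of consecutive integers, and let $I_m\times I_n$ be the categorical product (a nonempty finite set of pairs is a simplex iff both of its projections are simplices). A face sphere of size $m\times n$ $(m,n\ge0)$ is a simplicial map $f\colon I_m\times I_n\to X$ with $f(i,j)=x_0$ whenever $i\in\{0,m\}$ or $j\in\{0,n\}$. Face spheres $f,g$ of the same size are contiguous if $f(\tau)\cup g(\tau)$ is a simplex of $X$ for every simplex $\tau$ of $I_m\times I_n$, and contiguity equivalent if they are joined by a finite sequence of contiguities through face spheres of that size. A trivial extension of $f$ is a face sphere on a rectangle $I_{m+r}\times I_{n+s}\supseteq I_m\times I_n$ $(r,s\ge0)$ that equals $f$ on $I_m\times I_n$ and $x_0$ elsewhere. Two face spheres are extension-contiguity equivalent if they have trivial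 extensions of a common size that are contiguity equivalent; $F(X,x_0)$ is the set of equivalence classes of face spheres of all sizes. It is a group under the product induced by $f\cdot g$, where for $f$ of size $m\times n$ and $g$ of size $r\times s$ the face sphere $f\cdot g$ has size $(m+r+1)\times(n+s+1)$, equals $f(i,j)$ for $i\le m$, $j\le n$, equals $g(i-m-1,j-n-1)$ for $i\ge m+1$, $j\ge n+1$, and equals $x_0$ elsewhere. **The map $\Phi$.** For a face sphere $f$ of size $m\times n$ with rows $l^j=(f(0,j),f(1,j),\dots,f(m,j))$, $0\le j\le n$ (so $l^0=l^n=\mathbf{x_0^m}$), let $\Phi(f)$ be the edge loop of length $2m+n$ in $\Omega X$ based at $\mathbf{x_0}$ given by $$\Phi(f)=(\mathbf{x_0},\mathbf{x_0^1},\dots,\mathbf{x_0^m}=l^0,\,l^1,\dots,l^{n-1},\,l^n=\mathbf{x_0^m},\dots,\mathbf{x_0^1},\mathbf{x_0}).$$ **Theorem.** For every based simplicial complex $(X,x_0)$, the assignment $[f]\mapsto[\Phi(f)]$ is well defined and is an isomorphism of groups $$F(X,x_0)\;\xrightarrow{\ \cong\ }\;E(\Omega X,\mathbf{x_0}).$$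 -/

import Mathlib

namespace SimplicialLoop

universe u

variable {V : Type u}

/-! ### Simplices, simplicial maps, contiguity -/

/-- The set of vertices `S` is (the vertex set of) a simplex of `X`. -/
def IsSimplex (X : AbstractSimplicialComplex V) (S : Set V) : Prop :=
  ∃ t ∈ X.faces, (t : Set V) = S

theorem isSimplex_singleton (X : AbstractSimplicialComplex V) (v : V) : IsSimplex X {v} :=
  ⟨{v}, X.singleton_mem v, by simp⟩

theorem IsSimplex.mono {X : AbstractSimplicialComplex V} {S T : Set V} (hS : IsSimplex X S)
    (hT : T ⊆ S) (hne : T.Nonempty) : IsSimplex X T := by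
  classical
  obtain ⟨t, ht, rfl⟩ := hS
  have hfin : T.Finite := t.finite_toSet.subset hT
  refine ⟨hfin.toFinset, (X.isRelLowerSet_faces ht).2 ?_ ?_, by simp⟩
  · intro x hx
    exact hT (by simpa using hx)
  · simpa using hne

/-- The simplicial complex `I_m`: its vertices are the integers `0, …, m`, its simplices are the
vertices and the pairs of consecutive integers. -/
def interval (m : ℕ) : PreAbstractSimplicialComplex ℕ where
  faces := {s | s.Nonempty ∧ (∀ a ∈ s, a ≤ m) ∧ ∀ a ∈ s, ∀ b ∈ s, b ≤ a + 1}
  isRelLowerSet_faces := by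
    rintro s ⟨hne, hm, hs⟩
    exact ⟨hne, fun t hts ht =>
      ⟨ht, fun a ha => hm a (hts ha), fun a ha b hb => hs a (hts ha) b (hts hb)⟩⟩

/-- The categorical product of simplicial complexes: a nonempty finite set of pairs is a simplex
when both of its projections are simplices. -/
def prodComplex {A B : Type*} [DecidableEq A] [DecidableEq B]
    (K : PreAbstractSimplicialComplex A) (L : PreAbstractSimplicialComplex B) :
    PreAbstractSimplicialComplex (A × B) where
  faces := {s | s.image Prod.fst ∈ K.faces ∧ s.image Prod.snd ∈ L.faces}
  isRelLowerSet_faces := by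
    rintro s ⟨h1, h2⟩
    refine ⟨Finset.image_nonempty.1 (K.isRelLowerSet_faces h1).1, fun t hts ht => ⟨?_, ?_⟩⟩
    · exact (K.isRelLowerSet_faces h1).2 (Finset.image_subset_image hts)
        (Finset.image_nonempty.2 ht)
    · exact (L.isRelLowerSet_faces h2).2 (Finset.image_subset_image hts)
        (Finset.image_nonempty.2 ht)

/-- The vertex map `f` sends every simplex of `K` to a simplex of `X`. -/
def IsSimplicialMap {A : Type*} (K : PreAbstractSimplicialComplex A)
    (X : AbstractSimplicialComplex V) (f : A → V) : Prop :=
  ∀ σ ∈ K.faces, IsSimplex X (f '' (σ : Set A))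

/-- Contiguity of vertex maps: `f(σ) ∪ g(σ)` is a simplex of `X` for each simplex `σ` of `K`. -/
def Contiguous {A : Type*} (K : PreAbstractSimplicialComplex A)
    (X : AbstractSimplicialComplex V) (f g : A → V) : Prop :=
  ∀ σ ∈ K.faces, IsSimplex X (f '' (σ : Set A) ∪ g '' (σ : Set A))

/-! ### Based edge loops -/

/-- A based edge loop `(x₀ = v_0, v_1, …, v_len = x₀)` in `X`: each `{v_i, v_{i+1}}` is a simplex.
Only `vert 0, …, vert len` are data; beyond `len` the sequence is normalised to be `x₀`
(condition `finish`, which also contains `v_len = x₀`), so that two loops are equal exactly when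
they have the same length and the same vertices. -/
@[ext]
structure EdgeLoop (X : AbstractSimplicialComplex V) (x₀ : V) where
  /-- the length -/
  len : ℕ
  /-- the sequence of vertices -/
  vert : ℕ → V
  start : vert 0 = x₀
  finish : ∀ i, len ≤ i → vert i = x₀
  edge : ∀ i < len, IsSimplex X {vert i, vert (i + 1)}

variable {X : AbstractSimplicialComplex V} {x₀ : V}

namespace EdgeLoop

theorem edge' (l : EdgeLoop X x₀) (i : ℕ) : IsSimplex X {l.vert i, l.vert (i + 1)} := by
  by_cases h : i < l.len
  · exact l.edge i h
  · rw [l.finish i (by omega), l.finish (i + 1) (by omega)]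
    simpa using isSimplex_singleton X x₀

/-- The constant loop `(x₀, x₀, …, x₀)` of length `m`. -/
def const (X : AbstractSimplicialComplex V) (x₀ : V) (m : ℕ) : EdgeLoop X x₀ where
  len := m
  vert _ := x₀
  start := rfl
  finish _ _ := rfl
  edge _ _ := by simpa using isSimplex_singleton X x₀

/-- The extension of a loop that repeats its `i`th vertex. -/
def repeatVertex (l : EdgeLoop X x₀) (i : ℕ) (_hi : i ≤ l.len) : EdgeLoop X x₀ where
  len := l.len + 1
  vert s := if s ≤ i then l.vert s else l.vert (s - 1)
  start := by simp [l.start]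
  finish s hs := by
    split_ifs
    · omega
    · exact l.finish _ (by omega)
  edge s _ := by
    rcases lt_trichotomy s i with h | h | h
    · simpa [h.le, Nat.succ_le_of_lt h] using l.edge' s
    · subst h
      simpa using isSimplex_singleton X (l.vert s)
    · have h1 : ¬ s ≤ i := by omega
      have h2 : ¬ s + 1 ≤ i := by omega
      have h3 := l.edge' (s - 1)
      rw [Nat.sub_add_cancel (by omega)] at h3
      simpa [h1, h2] using h3

/-- The elementary moves on based edge loops: repeat a vertex, or replace a single vertex `v_i` by
`v'_i` when `{v_{i-1}, v_i, v'_i}` and `{v_i, v'_i, v_{i+1}}` are simplices. -/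
inductive Move : EdgeLoop X x₀ → EdgeLoop X x₀ → Prop
  | extend (l : EdgeLoop X x₀) (i : ℕ) (hi : i ≤ l.len) : Move l (l.repeatVertex i hi)
  | replace (l l' : EdgeLoop X x₀) (i : ℕ) (hlen : l'.len = l.len) (h0 : 0 < i) (hi : i < l.len)
      (hne : ∀ j, j ≠ i → l'.vert j = l.vert j)
      (hleft : IsSimplex X {l.vert (i - 1), l.vert i, l'.vert i})
      (hright : IsSimplex X {l.vert i, l'.vert i, l.vert (i + 1)}) : Move l l'

/-- Concatenation: the loop `(x₀, v_1, …, x₀, x₀, v'_1, …, x₀)` of length `m + n + 1`. -/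
def concat (l l' : EdgeLoop X x₀) : EdgeLoop X x₀ where
  len := l.len + l'.len + 1
  vert s := if s ≤ l.len then l.vert s else l'.vert (s - (l.len + 1))
  start := by simp [l.start]
  finish s hs := by
    split_ifs
    · omega
    · exact l'.finish _ (by omega)
  edge s _ := by
    rcases lt_trichotomy s l.len with h | h | h
    · simpa [h.le, Nat.succ_le_of_lt h] using l.edge' s
    · subst h
      simpa [l.finish _ le_rfl, l'.start] using isSimplex_singleton X x₀
    · have h1 : ¬ s ≤ l.len := by omega
      have h2 : ¬ s + 1 ≤ l.len := by omega
      have h3 := l'.edge' (s - (l.len + 1))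
      rw [← Nat.sub_add_comm (by omega)] at h3
      simpa only [h1, h2, if_false] using h3

/-- The reverse loop. -/
def reverse (l : EdgeLoop X x₀) : EdgeLoop X x₀ where
  len := l.len
  vert s := l.vert (l.len - s)
  start := by simp [l.finish]
  finish s hs := by rw [Nat.sub_eq_zero_of_le hs, l.start]
  edge s hs := by
    have h := l.edge' (l.len - (s + 1))
    rw [show l.len - (s + 1) + 1 = l.len - s by omega] at h
    rwa [Set.pair_comm]

end EdgeLoop

/-- The edge group `E(X, x₀)` as a set: based edge loops modulo the equivalence relation
generated by the elementary moves. -/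
def EdgeGroup (X : AbstractSimplicialComplex V) (x₀ : V) : Type u :=
  Quot (EdgeLoop.Move : EdgeLoop X x₀ → EdgeLoop X x₀ → Prop)

namespace EdgeLoop

/-- The class of a based edge loop in the edge group. -/
def toEdgeGroup (l : EdgeLoop X x₀) : EdgeGroup X x₀ := Quot.mk _ l

theorem concat_move_left {l k : EdgeLoop X x₀} (h : Move l k) (l' : EdgeLoop X x₀) :
    Move (l.concat l') (k.concat l') := by
  cases h with
  | extend i hi =>
    have : (l.repeatVertex i hi).concat l' = (l.concat l').repeatVertex i
        (by simp [concat]; omega) := by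
      ext s
      · simp [concat, repeatVertex]; omega
      · simp only [concat, repeatVertex]
        grind
    rw [this]
    exact .extend _ _ _
  | replace _ i hlen h0 hi hne hl hr =>
    refine .replace _ _ i ?_ h0 ?_ ?_ ?_ ?_
    · simp [concat, hlen]
    · simp [concat]; omega
    · intro j hj
      simp [concat, hlen, hne j hj]
    · have h1 : i - 1 ≤ l.len := by omega
      simpa [concat, hlen, hi.le, h1] using hl
    · simpa [concat, hlen, hi.le, Nat.succ_le_of_lt hi] using hr

theorem concat_move_right (l : EdgeLoop X x₀) {l' k : EdgeLoop X x₀} (h : Move l' k) :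
    Move (l.concat l') (l.concat k) := by
  cases h with
  | extend i hi =>
    have : l.concat (l'.repeatVertex i hi) = (l.concat l').repeatVertex (l.len + 1 + i)
        (by simp [concat]; omega) := by
      ext s
      · simp [concat, repeatVertex]; omega
      · simp only [concat, repeatVertex]
        grind
    rw [this]
    exact .extend _ _ _
  | replace _ i hlen h0 hi hne hl hr =>
    have e1 : ¬ l.len + 1 + i ≤ l.len := by omega
    have e2 : ¬ l.len + 1 + i - 1 ≤ l.len := by omega
    have e3 : ¬ l.len + 1 + i + 1 ≤ l.len := by omega
    have d1 : l.len + 1 + i - (l.len + 1) = i := by omega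
    have d2 : l.len + 1 + i - 1 - (l.len + 1) = i - 1 := by omega
    have d3 : l.len + 1 + i + 1 - (l.len + 1) = i + 1 := by omega
    refine .replace _ _ (l.len + 1 + i) ?_ (by omega) ?_ ?_ ?_ ?_
    · simp [concat, hlen]
    · simp [concat]; omega
    · intro j hj
      simp only [concat]
      split_ifs
      · rfl
      · exact hne _ (by omega)
    · simp only [concat, e1, e2, if_false, d1, d2]
      exact hl
    · simp only [concat, e1, e3, if_false, d1, d3]
      exact hr

theorem reverse_move {l k : EdgeLoop X x₀} (h : Move l k) : Move l.reverse k.reverse := by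
  cases h with
  | extend i hi =>
    have : (l.repeatVertex i hi).reverse = l.reverse.repeatVertex (l.len - i)
        (by simp [reverse]) := by
      ext s
      · simp [reverse, repeatVertex]
      · simp only [reverse, repeatVertex]
        split_ifs
        · congr 1; omega
        · congr 1; omega
        · congr 1; omega
        · congr 1; omega
    rw [this]
    exact .extend _ _ _
  | replace _ i hlen h0 hi hne hl hr =>
    have e1 : l.len - (l.len - i) = i := by omega
    have e2 : l.len - (l.len - i - 1) = i + 1 := by omega
    have e3 : l.len - (l.len - i + 1) = i - 1 := by omega
    refine .replace _ _ (l.len - i) ?_ (by omega) ?_ ?_ ?_ ?_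
    · simp [reverse, hlen]
    · simp only [reverse]; omega
    · intro j hj
      simp only [reverse, hlen]
      by_cases hj' : j ≤ l.len
      · exact hne _ (by omega)
      · rw [Nat.sub_eq_zero_of_le (by omega), l.start, k.start]
    · simp only [reverse, hlen, e1, e2]
      convert hr using 1
      grind
    · simp only [reverse, hlen, e1, e3]
      convert hl using 1
      grind

/-- Contiguous loops of the same length represent the same element of the edge group. -/
theorem toEdgeGroup_eq_of_contiguous (l k : EdgeLoop X x₀) (hlen : k.len = l.len)
    (h : ∀ i < l.len, IsSimplex X {l.vert i, l.vert (i + 1), k.vert i, k.vert (i + 1)}) :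
    l.toEdgeGroup = k.toEdgeGroup := by
  let c : ℕ → EdgeLoop X x₀ := fun p =>
    { len := l.len
      vert := fun s => if s < p then k.vert s else l.vert s
      start := by simp [l.start, k.start]
      finish := fun s hs => by simp [l.finish s hs, k.finish s (hlen ▸ hs)]
      edge := fun s hs => (h s hs).mono (by grind) (by simp) }
  have h0 : c 0 = l := by
    ext s <;> simp [c]
  have h1 : c l.len = k := by
    ext s
    · simp [c, hlen]
    · simp only [c]
      split_ifs with hs
      · rfl
      · rw [l.finish s (by omega), k.finish s (by omega)]
  have step : ∀ p, p ≤ l.len → (c 0).toEdgeGroup = (c p).toEdgeGroup := by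
    intro p
    induction p with
    | zero => intro _; rfl
    | succ p ih =>
      intro hp
      rw [ih (by omega)]
      rcases Nat.eq_zero_or_pos p with rfl | hpos
      · congr 1
        ext s
        · rfl
        · simp only [c]
          split_ifs with h2
          · omega
          · omega
          · obtain rfl : s = 0 := by omega
            rw [l.start, k.start]
          · rfl
      · refine Quot.sound (.replace _ _ p rfl hpos (by simpa [c] using hp) ?_ ?_ ?_)
        · intro j hj
          simp only [c]
          grind
        · have := h (p - 1) (by omega)
          rw [Nat.sub_add_cancel hpos] at this
          refine this.mono ?_ (by simp)
          simp only [c]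
          grind
        · refine (h p (by omega)).mono ?_ (by simp)
          simp only [c]
          grind
  rw [← h0, ← h1]
  exact step _ le_rfl

theorem const_toEdgeGroup (m : ℕ) :
    (const X x₀ m).toEdgeGroup = (const X x₀ 0).toEdgeGroup := by
  induction m with
  | zero => rfl
  | succ m ih =>
    rw [← ih]
    have : const X x₀ (m + 1) = (const X x₀ m).repeatVertex 0 (Nat.zero_le _) := by
      ext s <;> simp [const, repeatVertex]
    rw [this]
    exact (Quot.sound (.extend _ _ _)).symm

theorem reverse_concat_toEdgeGroup (l : EdgeLoop X x₀) :
    (l.reverse.concat l).toEdgeGroup = (const X x₀ 0).toEdgeGroup := by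
  let φ : ℕ → ℕ := fun s => if s ≤ l.len then l.len - s else s - (l.len + 1)
  have hφ : ∀ s, φ (s + 1) ≤ φ s + 1 ∧ φ s ≤ φ (s + 1) + 1 := by
    intro s
    simp only [φ]
    split_ifs <;> omega
  have hpair : ∀ a b p : ℕ, b ≤ a + 1 → a ≤ b + 1 →
      IsSimplex X {l.vert (max a p), l.vert (max b p), l.vert (max a (p + 1)),
        l.vert (max b (p + 1))} := by
    intro a b p hab hba
    have hk : ∃ q, ∀ x ∈ ({max a p, max b p, max a (p + 1), max b (p + 1)} : Set ℕ),
        x = q ∨ x = q + 1 := by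
      refine ⟨min (max a p) (max b p), ?_⟩
      simp only [Set.mem_insert_iff, Set.mem_singleton_iff]
      rintro x (rfl | rfl | rfl | rfl) <;> omega
    obtain ⟨q, hq⟩ := hk
    refine (l.edge' q).mono ?_ (by simp)
    intro v hv
    simp only [Set.mem_insert_iff, Set.mem_singleton_iff] at hv hq ⊢
    rcases hv with rfl | rfl | rfl | rfl
    · rcases hq (max a p) (by simp) with h | h <;> simp [h]
    · rcases hq (max b p) (by simp) with h | h <;> simp [h]
    · rcases hq (max a (p + 1)) (by simp) with h | h <;> simp [h]
    · rcases hq (max b (p + 1)) (by simp) with h | h <;> simp [h]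
  let c : ∀ p : ℕ, p ≤ l.len → EdgeLoop X x₀ := fun p hp =>
    { len := l.len + l.len + 1
      vert := fun s => l.vert (max (φ s) p)
      start := l.finish _ (by simp [φ])
      finish := fun s hs => l.finish _ (by simp only [φ]; split_ifs <;> omega)
      edge := fun s _ => (hpair (φ s) (φ (s + 1)) p (hφ s).1 (hφ s).2).mono (by grind) (by simp) }
  have h0 : c 0 (Nat.zero_le _) = l.reverse.concat l := by
    ext s
    · rfl
    · simp only [c, φ, concat, reverse, Nat.max_zero]
      grind
  have h1 : c l.len le_rfl = const X x₀ (l.len + l.len + 1) := by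
    ext s
    · rfl
    · exact l.finish _ (le_max_right _ _)
  have step : ∀ p (hp : p ≤ l.len),
      (c 0 (Nat.zero_le _)).toEdgeGroup = (c p hp).toEdgeGroup := by
    intro p
    induction p with
    | zero => intro _; rfl
    | succ p ih =>
      intro hp
      rw [ih (by omega)]
      refine toEdgeGroup_eq_of_contiguous _ _ rfl ?_
      intro s _
      exact hpair (φ s) (φ (s + 1)) p (hφ s).1 (hφ s).2
  rw [← h0, step _ le_rfl, h1, const_toEdgeGroup]

end EdgeLoop

namespace EdgeGroup

instance : One (EdgeGroup X x₀) := ⟨(EdgeLoop.const X x₀ 0).toEdgeGroup⟩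

instance : Mul (EdgeGroup X x₀) :=
  ⟨Quot.map₂ EdgeLoop.concat (fun l _ _ h => EdgeLoop.concat_move_right l h)
    (fun _ _ l' h => EdgeLoop.concat_move_left h l')⟩

instance : Inv (EdgeGroup X x₀) :=
  ⟨Quot.map EdgeLoop.reverse (fun _ _ h => EdgeLoop.reverse_move h)⟩

/-- The group structure of the edge group: the product is induced by concatenation, the unit is
the class of the loop of length zero, inverses are given by reversal. -/
instance : Group (EdgeGroup X x₀) :=
  Group.ofLeftAxioms
    (by
      rintro ⟨a⟩ ⟨b⟩ ⟨c⟩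
      change ((a.concat b).concat c).toEdgeGroup = (a.concat (b.concat c)).toEdgeGroup
      congr 1
      ext s
      · simp [EdgeLoop.concat]; omega
      · simp only [EdgeLoop.concat]
        grind)
    (by
      rintro ⟨a⟩
      change ((EdgeLoop.const X x₀ 0).concat a).toEdgeGroup = a.toEdgeGroup
      have : (EdgeLoop.const X x₀ 0).concat a = a.repeatVertex 0 (Nat.zero_le _) := by
        ext s
        · simp [EdgeLoop.concat, EdgeLoop.repeatVertex, EdgeLoop.const]
        · simp only [EdgeLoop.concat, EdgeLoop.repeatVertex, EdgeLoop.const]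
          have := a.start
          grind
      rw [this]
      exact (Quot.sound (.extend _ _ _)).symm)
    (by
      rintro ⟨a⟩
      exact EdgeLoop.reverse_concat_toEdgeGroup a)

end EdgeGroup

/-! ### The simplicial loop space -/

/-- The simplicial complex `ΩX`. Its vertices are the based edge loops of `X` of all lengths. A
nonempty finite set `σ` of loops is a simplex when, for some `m`, at least one member has length
`m`, all others have length `m` or `m - 1`, and for each `0 ≤ i ≤ m - 1` the `i`th and `(i+1)`st
vertices of all members together form a simplex of `X`. (A loop of length `m - 1` has `m`th vertex
`x₀` by the normalisation, that is, it is trivially extended by one.) -/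
def loopComplex (X : AbstractSimplicialComplex V) (x₀ : V) :
    AbstractSimplicialComplex (EdgeLoop X x₀) where
  faces := {σ | ∃ m, (∃ l ∈ σ, l.len = m) ∧ (∀ l ∈ σ, l.len = m ∨ l.len + 1 = m) ∧
    ∀ i < m, IsSimplex X
      ((fun l : EdgeLoop X x₀ => l.vert i) '' σ ∪ (fun l : EdgeLoop X x₀ => l.vert (i + 1)) '' σ)}
  isRelLowerSet_faces := by
    rintro σ ⟨m, ⟨l₀, hl₀, -⟩, hlen, hs⟩
    refine ⟨⟨l₀, hl₀⟩, fun τ hτ hne => ?_⟩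
    have hsub : ∀ i, IsSimplex X ((fun l : EdgeLoop X x₀ => l.vert i) '' σ ∪
          (fun l : EdgeLoop X x₀ => l.vert (i + 1)) '' σ) →
        IsSimplex X ((fun l : EdgeLoop X x₀ => l.vert i) '' τ ∪
          (fun l : EdgeLoop X x₀ => l.vert (i + 1)) '' τ) := fun i hi =>
      hi.mono (Set.union_subset_union (Set.image_mono (Finset.coe_subset.2 hτ))
        (Set.image_mono (Finset.coe_subset.2 hτ)))
        (Set.Nonempty.inl ((Finset.coe_nonempty.2 hne).image _))
    by_cases hm : ∃ l ∈ τ, l.len = m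
    · exact ⟨m, hm, fun l hl => hlen l (hτ hl), fun i hi => hsub i (hs i hi)⟩
    · push Not at hm
      have hlen' : ∀ l ∈ τ, l.len + 1 = m := fun l hl =>
        (hlen l (hτ hl)).resolve_left (hm l hl)
      obtain ⟨l, hl⟩ := hne
      have hlm := hlen' l hl
      refine ⟨l.len, ⟨l, hl, rfl⟩, fun k hk => Or.inl ?_, fun i hi => hsub i (hs i (by omega))⟩
      have := hlen' k hk
      omega
  singleton_mem l := by
    refine ⟨l.len, ⟨l, by simp, rfl⟩, by simp, fun i hi => ?_⟩
    simpa [Set.pair_comm] using l.edge i hi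

/-- The basepoint of `ΩX`: the edge loop of length zero. -/
def loopBase (X : AbstractSimplicialComplex V) (x₀ : V) : EdgeLoop X x₀ := EdgeLoop.const X x₀ 0

/-! ### Face spheres -/

/-- A face sphere of size `width × height` in `X`: a simplicial map
`I_width × I_height → X` that is constant at `x₀` on the boundary of the rectangle.
Only the values on the rectangle are data; off the rectangle the map is normalised to be `x₀`
(the strict cases of the inequalities in `boundary`), so that two face spheres are equal exactly
when they have the same size and the same values on the rectangle. -/
@[ext]
structure FaceSphere (X : AbstractSimplicialComplex V) (x₀ : V) where
  /-- the first side length -/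
  width : ℕ
  /-- the second side length -/
  height : ℕ
  /-- the vertex map -/
  val : ℕ × ℕ → V
  simplicial : IsSimplicialMap (prodComplex (interval width) (interval height)) X val
  boundary : ∀ i j, i = 0 ∨ width ≤ i ∨ j = 0 ∨ height ≤ j → val (i, j) = x₀

/-- Auxiliary form of contiguity, over all unit squares. -/
def SquareAdj (X : AbstractSimplicialComplex V) (f g : ℕ × ℕ → V) : Prop :=
  ∀ i j, ∃ S, IsSimplex X S ∧ ∀ a b, i ≤ a → a ≤ i + 1 → j ≤ b → b ≤ j + 1 →
    f (a, b) ∈ S ∧ g (a, b) ∈ S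

theorem exists_square {m n : ℕ} {σ : Finset (ℕ × ℕ)}
    (hσ : σ ∈ (prodComplex (interval m) (interval n)).faces) :
    ∃ i j, ∀ p ∈ σ, i ≤ p.1 ∧ p.1 ≤ i + 1 ∧ j ≤ p.2 ∧ p.2 ≤ j + 1 := by
  obtain ⟨⟨hne1, -, h1⟩, ⟨hne2, -, h2⟩⟩ := hσ
  refine ⟨(σ.image Prod.fst).min' hne1, (σ.image Prod.snd).min' hne2, fun p hp => ?_⟩
  have hp1 : p.1 ∈ σ.image Prod.fst := Finset.mem_image_of_mem _ hp
  have hp2 : p.2 ∈ σ.image Prod.snd := Finset.mem_image_of_mem _ hp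
  exact ⟨Finset.min'_le _ _ hp1, h1 _ (Finset.min'_mem _ _) _ hp1,
    Finset.min'_le _ _ hp2, h2 _ (Finset.min'_mem _ _) _ hp2⟩

theorem SquareAdj.contiguous {f g : ℕ × ℕ → V} (h : SquareAdj X f g) (m n : ℕ) :
    Contiguous (prodComplex (interval m) (interval n)) X f g := by
  intro σ hσ
  obtain ⟨i, j, hij⟩ := exists_square hσ
  obtain ⟨S, hS, hS'⟩ := h i j
  have hne : σ.Nonempty := ((prodComplex (interval m) (interval n)).isRelLowerSet_faces hσ).1
  refine hS.mono ?_ (Set.Nonempty.inl ((Finset.coe_nonempty.2 hne).image _))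
  rintro v (⟨p, hp, rfl⟩ | ⟨p, hp, rfl⟩)
  · obtain ⟨h1, h2, h3, h4⟩ := hij p hp
    exact (hS' p.1 p.2 h1 h2 h3 h4).1
  · obtain ⟨h1, h2, h3, h4⟩ := hij p hp
    exact (hS' p.1 p.2 h1 h2 h3 h4).2

theorem SquareAdj.simplicial {f : ℕ × ℕ → V} (h : SquareAdj X f f) (m n : ℕ) :
    IsSimplicialMap (prodComplex (interval m) (interval n)) X f := by
  intro σ hσ
  have := h.contiguous m n σ hσ
  rwa [Set.union_self] at this

theorem squareAdj_of_contiguous {f g : ℕ × ℕ → V} {m n : ℕ}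
    (h : Contiguous (prodComplex (interval m) (interval n)) X f g)
    (hf : ∀ i j, i = 0 ∨ m ≤ i ∨ j = 0 ∨ n ≤ j → f (i, j) = x₀)
    (hg : ∀ i j, i = 0 ∨ m ≤ i ∨ j = 0 ∨ n ≤ j → g (i, j) = x₀) : SquareAdj X f g := by
  intro i j
  by_cases hij : i < m ∧ j < n
  · refine ⟨_, h ({i, i + 1} ×ˢ {j, j + 1}) ?_, ?_⟩
    · constructor
      · rw [Finset.product_image_fst (by simp)]
        refine ⟨by simp, ?_, ?_⟩
        · simp; omega
        · simp; omega
      · rw [Finset.product_image_snd (by simp)]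
        refine ⟨by simp, ?_, ?_⟩
        · simp; omega
        · simp; omega
    · intro a b h1 h2 h3 h4
      have hab : (a, b) ∈ (({i, i + 1} ×ˢ {j, j + 1} : Finset (ℕ × ℕ)) : Set (ℕ × ℕ)) := by
        simp; omega
      exact ⟨Or.inl ⟨_, hab, rfl⟩, Or.inr ⟨_, hab, rfl⟩⟩
  · refine ⟨{x₀}, isSimplex_singleton X x₀, fun a b h1 h2 h3 h4 => ?_⟩
    have : a = 0 ∨ m ≤ a ∨ b = 0 ∨ n ≤ b := by omega
    simp [hf a b this, hg a b this]

/-- Two maps of the integer line that are contiguous. -/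
def LineAdj (a a' : ℕ → ℕ) : Prop :=
  ∀ i, ∃ k, ∀ t, i ≤ t → t ≤ i + 1 → k ≤ a t ∧ a t ≤ k + 1 ∧ k ≤ a' t ∧ a' t ≤ k + 1

theorem LineAdj.left {a a' : ℕ → ℕ} (h : LineAdj a a') : LineAdj a a := fun i => by
  obtain ⟨k, hk⟩ := h i
  exact ⟨k, fun t h1 h2 => by have := hk t h1 h2; omega⟩

theorem SquareAdj.comp {f g : ℕ × ℕ → V} (h : SquareAdj X f g) {a a' b b' : ℕ → ℕ}
    (ha : LineAdj a a') (hb : LineAdj b b') :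
    SquareAdj X (fun p => f (a p.1, b p.2)) (fun p => g (a' p.1, b' p.2)) := by
  intro i j
  obtain ⟨k, hk⟩ := ha i
  obtain ⟨l, hl⟩ := hb j
  obtain ⟨S, hS, hS'⟩ := h k l
  refine ⟨S, hS, fun s t h1 h2 h3 h4 => ?_⟩
  obtain ⟨k1, k2, k3, k4⟩ := hk s h1 h2
  obtain ⟨l1, l2, l3, l4⟩ := hl t h3 h4
  exact ⟨(hS' _ _ k1 k2 l1 l2).1, (hS' _ _ k3 k4 l3 l4).2⟩

/-- The map of the line that repeats the value `i` another `r` times. -/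
def stretch (i r s : ℕ) : ℕ := min s (max i (s - r))

theorem lineAdj_stretch (i r : ℕ) : LineAdj (stretch i r) (stretch (i + 1) r) := by
  intro s
  refine ⟨stretch i r s, fun t h1 h2 => ?_⟩
  simp only [stretch]
  omega

theorem lineAdj_stretch_self (i r : ℕ) : LineAdj (stretch i r) (stretch i r) :=
  (lineAdj_stretch i r).left

namespace FaceSphere

theorem squareAdj (f : FaceSphere X x₀) : SquareAdj X f.val f.val :=
  squareAdj_of_contiguous (x₀ := x₀) (m := f.width) (n := f.height)
    (fun σ hσ => by rw [Set.union_self]; exact f.simplicial σ hσ) f.boundary f.boundary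

/-- Contiguity of face spheres of the same size. -/
def Contig (f g : FaceSphere X x₀) : Prop :=
  g.width = f.width ∧ g.height = f.height ∧
    Contiguous (prodComplex (interval f.width) (interval f.height)) X f.val g.val

/-- Contiguity equivalence relative to the boundary: a finite sequence
`f ∼ f_1 ∼ ⋯ ∼ g` of contiguities through face spheres. -/
def ContigEquiv (f g : FaceSphere X x₀) : Prop := Relation.ReflTransGen Contig f g

/-- `f'` is a trivial extension of `f`: it is defined on a rectangle that contains that of `f`, it
agrees with `f` there, and is `x₀` elsewhere. -/
def IsTrivialExtension (f f' : FaceSphere X x₀) : Prop :=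
  f.width ≤ f'.width ∧ f.height ≤ f'.height ∧
    ∀ i j, f'.val (i, j) = if i ≤ f.width ∧ j ≤ f.height then f.val (i, j) else x₀

/-- Extension-contiguity equivalence of face spheres: some trivial extensions to a common size are
contiguity equivalent. -/
def ExtContigEquiv (f g : FaceSphere X x₀) : Prop :=
  ∃ f' g' : FaceSphere X x₀,
    f.IsTrivialExtension f' ∧ g.IsTrivialExtension g' ∧ f'.ContigEquiv g'

theorem isTrivialExtension_iff {f f' : FaceSphere X x₀} :
    f.IsTrivialExtension f' ↔ f.width ≤ f'.width ∧ f.height ≤ f'.height ∧ f'.val = f.val := by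
  have key : ∀ i j, (if i ≤ f.width ∧ j ≤ f.height then f.val (i, j) else x₀) = f.val (i, j) := by
    intro i j
    split_ifs with h
    · rfl
    · exact (f.boundary i j (by omega)).symm
  simp only [IsTrivialExtension, key]
  refine and_congr_right fun _ => and_congr_right fun _ => ⟨fun h => ?_, fun h => ?_⟩
  · funext ⟨i, j⟩
    exact h i j
  · intro i j
    rw [h]

theorem contig_iff {f g : FaceSphere X x₀} :
    f.Contig g ↔ g.width = f.width ∧ g.height = f.height ∧ SquareAdj X f.val g.val := by
  refine and_congr_right fun h1 => and_congr_right fun h2 => ⟨fun h => ?_, fun h => ?_⟩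
  · refine squareAdj_of_contiguous h f.boundary ?_
    rw [← h1, ← h2]
    exact g.boundary
  · exact h.contiguous _ _

theorem Contig.symm {f g : FaceSphere X x₀} (h : f.Contig g) : g.Contig f := by
  rw [contig_iff] at h ⊢
  obtain ⟨h1, h2, h3⟩ := h
  refine ⟨h1.symm, h2.symm, fun i j => ?_⟩
  obtain ⟨S, hS, hS'⟩ := h3 i j
  exact ⟨S, hS, fun a b c1 c2 c3 c4 => (hS' a b c1 c2 c3 c4).symm⟩

theorem ContigEquiv.symm {f g : FaceSphere X x₀} (h : f.ContigEquiv g) : g.ContigEquiv f := by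
  induction h with
  | refl => exact .refl
  | tail _ h ih => exact .head h.symm ih

/-- The face sphere with given vertex map, from the auxiliary form of simpliciality. -/
def ofSquareAdj (m n : ℕ) (F : ℕ × ℕ → V) (hF : SquareAdj X F F)
    (hb : ∀ i j, i = 0 ∨ m ≤ i ∨ j = 0 ∨ n ≤ j → F (i, j) = x₀) : FaceSphere X x₀ where
  width := m
  height := n
  val := F
  simplicial := hF.simplicial m n
  boundary := hb

/-- The trivial extension by `r` columns and `s` rows. -/
def pad (f : FaceSphere X x₀) (r s : ℕ) : FaceSphere X x₀ :=
  ofSquareAdj (f.width + r) (f.height + s) f.val f.squareAdj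
    (fun i j h => f.boundary i j (by omega))

theorem pad_contig {f g : FaceSphere X x₀} (h : f.Contig g) (r s : ℕ) :
    (f.pad r s).Contig (g.pad r s) := by
  rw [contig_iff] at h ⊢
  exact ⟨by simp [pad, ofSquareAdj, h.1], by simp [pad, ofSquareAdj, h.2.1], h.2.2⟩

theorem pad_contigEquiv {f g : FaceSphere X x₀} (h : f.ContigEquiv g) (r s : ℕ) :
    (f.pad r s).ContigEquiv (g.pad r s) := by
  induction h with
  | refl => exact .refl
  | tail _ h ih => exact .tail ih (pad_contig h r s)

theorem ContigEquiv.size {f g : FaceSphere X x₀} (h : f.ContigEquiv g) :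
    g.width = f.width ∧ g.height = f.height := by
  induction h with
  | refl => exact ⟨rfl, rfl⟩
  | tail _ h ih => exact ⟨h.1.trans ih.1, h.2.1.trans ih.2⟩

theorem isTrivialExtension_pad (f : FaceSphere X x₀) (r s : ℕ) : f.IsTrivialExtension (f.pad r s) :=
  isTrivialExtension_iff.2 ⟨Nat.le_add_right _ _, Nat.le_add_right _ _, rfl⟩

theorem IsTrivialExtension.trans {f g h : FaceSphere X x₀} (h1 : f.IsTrivialExtension g)
    (h2 : g.IsTrivialExtension h) : f.IsTrivialExtension h := by
  rw [isTrivialExtension_iff] at *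
  exact ⟨h1.1.trans h2.1, h1.2.1.trans h2.2.1, h2.2.2.trans h1.2.2⟩

theorem extContigEquiv_equivalence :
    Equivalence (ExtContigEquiv : FaceSphere X x₀ → FaceSphere X x₀ → Prop) where
  refl f := ⟨f.pad 0 0, f.pad 0 0, f.isTrivialExtension_pad 0 0, f.isTrivialExtension_pad 0 0,
    .refl⟩
  symm := by
    rintro f g ⟨f', g', hf, hg, h⟩
    exact ⟨g', f', hg, hf, h.symm⟩
  trans := by
    rintro f g k ⟨f', g', hf, hg, h⟩ ⟨g'', k'', hg', hk, h'⟩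
    have e : g'.pad g''.width g''.height = g''.pad g'.width g'.height := by
      rw [isTrivialExtension_iff] at hg hg'
      ext p
      · simp [pad, ofSquareAdj, Nat.add_comm]
      · simp [pad, ofSquareAdj, Nat.add_comm]
      · simp [pad, ofSquareAdj, hg.2.2, hg'.2.2]
    refine ⟨f'.pad g''.width g''.height, k''.pad g'.width g'.height,
      hf.trans (isTrivialExtension_pad _ _ _), hk.trans (isTrivialExtension_pad _ _ _), ?_⟩
    refine (pad_contigEquiv h _ _).trans ?_
    rw [e]
    exact pad_contigEquiv h' _ _

/-- Extension-contiguity equivalence as a setoid. -/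
instance setoid (X : AbstractSimplicialComplex V) (x₀ : V) : Setoid (FaceSphere X x₀) :=
  ⟨ExtContigEquiv, extContigEquiv_equivalence⟩

theorem IsTrivialExtension.equiv {f f' : FaceSphere X x₀} (h : f.IsTrivialExtension f') : f ≈ f' :=
  ⟨f', f'.pad 0 0, h, f'.isTrivialExtension_pad 0 0, .refl⟩

theorem Contig.equiv {f g : FaceSphere X x₀} (h : f.Contig g) : f ≈ g :=
  ⟨f.pad 0 0, g.pad 0 0, isTrivialExtension_pad _ _ _, isTrivialExtension_pad _ _ _,
    .single (pad_contig h 0 0)⟩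

/-- To respect equivalence it is enough to respect trivial extensions and contiguities. -/
theorem lift_equiv {F : FaceSphere X x₀ → FaceSphere X x₀}
    (h1 : ∀ f f', f.IsTrivialExtension f' → F f ≈ F f')
    (h2 : ∀ f g, f.Contig g → F f ≈ F g) {f g : FaceSphere X x₀} (h : f ≈ g) : F f ≈ F g := by
  obtain ⟨f', g', hf, hg, h⟩ := h
  have key : ∀ a b : FaceSphere X x₀, a.ContigEquiv b → F a ≈ F b := by
    intro a b hab
    induction hab with
    | refl => exact Setoid.refl _
    | tail _ h ih => exact Setoid.trans ih (h2 _ _ h)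
  exact Setoid.trans (h1 _ _ hf) (Setoid.trans (key _ _ h) (Setoid.symm (h1 _ _ hg)))

/-- Repeat the `i`th column `r` times and the `j`th row `s` times. -/
def stretchBy (f : FaceSphere X x₀) (i j r s : ℕ) : FaceSphere X x₀ :=
  ofSquareAdj (f.width + r) (f.height + s) (fun p => f.val (stretch i r p.1, stretch j s p.2))
    (f.squareAdj.comp (lineAdj_stretch_self i r) (lineAdj_stretch_self j s))
    (fun a b h => f.boundary _ _ (by simp only [stretch]; omega))

theorem stretchBy_equiv (f : FaceSphere X x₀) (i j r s : ℕ) : f ≈ f.stretchBy i j r s := by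
  have h1 : ∀ k, f.stretchBy i j r s ≈ f.stretchBy (i + k) j r s := by
    intro k
    induction k with
    | zero => exact Setoid.refl _
    | succ k ih =>
      exact Setoid.trans ih (Contig.equiv (contig_iff.2 ⟨rfl, rfl,
        f.squareAdj.comp (lineAdj_stretch (i + k) r) (lineAdj_stretch_self j s)⟩))
  have h2 : ∀ i' k, f.stretchBy i' j r s ≈ f.stretchBy i' (j + k) r s := by
    intro i' k
    induction k with
    | zero => exact Setoid.refl _
    | succ k ih =>
      exact Setoid.trans ih (Contig.equiv (contig_iff.2 ⟨rfl, rfl,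
        f.squareAdj.comp (lineAdj_stretch_self i' r) (lineAdj_stretch (j + k) s)⟩))
  refine Setoid.trans ?_ (Setoid.symm (Setoid.trans (h1 f.width) (h2 _ f.height)))
  refine IsTrivialExtension.equiv (isTrivialExtension_iff.2
    ⟨Nat.le_add_right _ _, Nat.le_add_right _ _, ?_⟩)
  funext ⟨a, b⟩
  change f.val (stretch (i + f.width) r a, stretch (j + f.height) s b) = f.val (a, b)
  by_cases hab : a ≤ i + f.width ∧ b ≤ j + f.height
  · congr 2 <;> simp only [stretch] <;> omega
  · rw [f.boundary a b (by omega), f.boundary]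
    simp only [stretch]
    omega

/-- The constant face sphere at `x₀`. -/
def const (X : AbstractSimplicialComplex V) (x₀ : V) (m n : ℕ) : FaceSphere X x₀ :=
  ofSquareAdj m n (fun _ => x₀)
    (fun _ _ => ⟨{x₀}, isSimplex_singleton X x₀, fun _ _ _ _ _ _ => ⟨rfl, rfl⟩⟩) (fun _ _ _ => rfl)

/-- The vertex map of the product `f · g`: `f` in the block `[0, w] × [0, h]`, `g` in the
block starting at `(w + 1, h + 1)`, and `x₀` elsewhere. -/
def mulVal (x₀ : V) (w h : ℕ) (f g : ℕ × ℕ → V) (p : ℕ × ℕ) : V :=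
  if p.1 ≤ w ∧ p.2 ≤ h then f p
  else if w + 1 ≤ p.1 ∧ h + 1 ≤ p.2 then g (p.1 - (w + 1), p.2 - (h + 1))
  else x₀

theorem squareAdj_mulVal {w h : ℕ} {f f' g g' : ℕ × ℕ → V} (hf : SquareAdj X f f')
    (hg : SquareAdj X g g')
    (bf : ∀ i j, w ≤ i ∨ h ≤ j → f (i, j) = x₀) (bf' : ∀ i j, w ≤ i ∨ h ≤ j → f' (i, j) = x₀)
    (bg : ∀ i j, i = 0 ∨ j = 0 → g (i, j) = x₀) (bg' : ∀ i j, i = 0 ∨ j = 0 → g' (i, j) = x₀) :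
    SquareAdj X (mulVal x₀ w h f g) (mulVal x₀ w h f' g') := by
  have low : ∀ (u v : ℕ × ℕ → V), (∀ i j, w ≤ i ∨ h ≤ j → u (i, j) = x₀) →
      (∀ i j, i = 0 ∨ j = 0 → v (i, j) = x₀) → ∀ a b, a ≤ w + 1 ∨ b ≤ h + 1 →
      mulVal x₀ w h u v (a, b) = u (a, b) := by
    intro u v hu hv a b hab
    simp only [mulVal]
    split_ifs with c1 c2
    · rfl
    · rw [hu a b (by omega), hv _ _ (by omega)]
    · rw [hu a b (by omega)]
  have high : ∀ (u v : ℕ × ℕ → V) (a b : ℕ), w + 1 ≤ a → h + 1 ≤ b →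
      mulVal x₀ w h u v (a, b) = v (a - (w + 1), b - (h + 1)) := by
    intro u v a b ha hb
    simp only [mulVal]
    rw [if_neg (by omega), if_pos (by omega)]
  intro i j
  by_cases hij : i ≤ w ∨ j ≤ h
  · obtain ⟨S, hS, hS'⟩ := hf i j
    refine ⟨S, hS, fun a b h1 h2 h3 h4 => ?_⟩
    rw [low f g bf bg a b (by omega), low f' g' bf' bg' a b (by omega)]
    exact hS' a b h1 h2 h3 h4
  · obtain ⟨S, hS, hS'⟩ := hg (i - (w + 1)) (j - (h + 1))
    refine ⟨S, hS, fun a b h1 h2 h3 h4 => ?_⟩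
    rw [high f g a b (by omega) (by omega), high f' g' a b (by omega) (by omega)]
    exact hS' _ _ (by omega) (by omega) (by omega) (by omega)

/-- The product of face spheres of sizes `m × n` and `r × s`, of size
`(m + r + 1) × (n + s + 1)`. -/
def mul (f g : FaceSphere X x₀) : FaceSphere X x₀ :=
  ofSquareAdj (f.width + g.width + 1) (f.height + g.height + 1)
    (mulVal x₀ f.width f.height f.val g.val)
    (squareAdj_mulVal f.squareAdj g.squareAdj (fun i j h => f.boundary i j (by omega))
      (fun i j h => f.boundary i j (by omega)) (fun i j h => g.boundary i j (by omega))
      (fun i j h => g.boundary i j (by omega)))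
    (by
      intro i j hij
      simp only [mulVal]
      split_ifs with c1 c2
      · exact f.boundary i j (by omega)
      · exact g.boundary _ _ (by omega)
      · rfl)

theorem mul_contig {f f' g g' : FaceSphere X x₀} (hf : f.Contig f') (hg : g.Contig g') :
    (f.mul g).Contig (f'.mul g') := by
  rw [contig_iff] at *
  obtain ⟨hf1, hf2, hf3⟩ := hf
  obtain ⟨hg1, hg2, hg3⟩ := hg
  refine ⟨by simp [mul, ofSquareAdj, hf1, hg1], by simp [mul, ofSquareAdj, hf2, hg2], ?_⟩
  simp only [mul, ofSquareAdj, hf1, hf2]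
  exact squareAdj_mulVal hf3 hg3 (fun i j h => f.boundary i j (by omega))
      (fun i j h => f'.boundary i j (by omega)) (fun i j h => g.boundary i j (by omega))
      (fun i j h => g'.boundary i j (by omega))

theorem contig_refl (f : FaceSphere X x₀) : f.Contig f := contig_iff.2 ⟨rfl, rfl, f.squareAdj⟩

theorem mul_equiv {f f' g g' : FaceSphere X x₀} (hf : f ≈ f') (hg : g ≈ g') :
    f.mul g ≈ f'.mul g' := by
  have h1 : f.mul g ≈ f'.mul g := by
    refine lift_equiv (F := fun f => f.mul g) ?_ (fun a b h => (mul_contig h g.contig_refl).equiv) hf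
    intro a a' ha
    obtain ⟨k1, k2, k3⟩ := isTrivialExtension_iff.1 ha
    obtain ⟨r, hr⟩ := Nat.exists_eq_add_of_le k1
    obtain ⟨s, hs⟩ := Nat.exists_eq_add_of_le k2
    have e : a'.mul g = (a.mul g).stretchBy a.width a.height r s := by
      ext ⟨i, j⟩
      · simp only [mul, stretchBy, ofSquareAdj]; omega
      · simp only [mul, stretchBy, ofSquareAdj]; omega
      · simp only [mul, stretchBy, ofSquareAdj, mulVal, k3, hr, hs]
        by_cases c1 : i ≤ a.width ∧ j ≤ a.height
        · have e1 : stretch a.width r i = i := by simp only [stretch]; omega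
          have e2 : stretch a.height s j = j := by simp only [stretch]; omega
          rw [e1, e2, if_pos (by omega), if_pos c1]
        by_cases c2 : a.width + r + 1 ≤ i ∧ a.height + s + 1 ≤ j
        · have e1 : stretch a.width r i = i - r := by simp only [stretch]; omega
          have e2 : stretch a.height s j = j - s := by simp only [stretch]; omega
          rw [e1, e2, if_neg (by omega), if_pos c2, if_neg (by omega), if_pos (by omega)]
          congr 2 <;> omega
        · have z : a.val (i, j) = x₀ := a.boundary _ _ (by omega)
          rw [if_neg c2, z, ite_self]
          split_ifs with d1 d2
          · refine (a.boundary _ _ ?_).symm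
            simp only [stretch] at d1 ⊢
            omega
          · exfalso
            simp only [stretch] at d2
            omega
          · rfl
    rw [e]
    exact stretchBy_equiv _ _ _ _ _
  have h2 : f'.mul g ≈ f'.mul g' := by
    refine lift_equiv (F := fun g => f'.mul g) ?_ (fun a b h => (mul_contig f'.contig_refl h).equiv) hg
    intro a a' ha
    obtain ⟨k1, k2, k3⟩ := isTrivialExtension_iff.1 ha
    refine IsTrivialExtension.equiv (isTrivialExtension_iff.2 ⟨?_, ?_, ?_⟩)
    · simp only [mul, ofSquareAdj]; omega
    · simp only [mul, ofSquareAdj]; omega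
    · simp only [mul, ofSquareAdj, k3]
  exact Setoid.trans h1 h2

theorem mul_assoc' (f g h : FaceSphere X x₀) : (f.mul g).mul h = f.mul (g.mul h) := by
  ext ⟨i, j⟩
  · simp only [mul, ofSquareAdj]; omega
  · simp only [mul, ofSquareAdj]; omega
  · simp only [mul, ofSquareAdj, mulVal]
    split_ifs <;> first | rfl | (exfalso; omega) | (congr 2 <;> omega)

theorem const_mul_equiv (f : FaceSphere X x₀) : (const X x₀ 0 0).mul f ≈ f := by
  have e : (const X x₀ 0 0).mul f = f.stretchBy 0 0 1 1 := by
    ext ⟨i, j⟩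
    · simp only [mul, const, stretchBy, ofSquareAdj]; omega
    · simp only [mul, const, stretchBy, ofSquareAdj]; omega
    · simp only [mul, const, stretchBy, ofSquareAdj, mulVal]
      by_cases c : 0 + 1 ≤ i ∧ 0 + 1 ≤ j
      · rw [if_neg (by omega), if_pos c]
        congr 2 <;> simp only [stretch] <;> omega
      · rw [if_neg c, ite_self]
        exact (f.boundary _ _ (by simp only [stretch]; omega)).symm
  rw [e]
  exact Setoid.symm (stretchBy_equiv _ _ _ _ _)

theorem const_equiv (m n : ℕ) : const X x₀ m n ≈ const X x₀ 0 0 :=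
  Setoid.symm (IsTrivialExtension.equiv
    (isTrivialExtension_iff.2 ⟨Nat.zero_le _, Nat.zero_le _, rfl⟩))

theorem lineAdj_of_step {a : ℕ → ℕ} (h : ∀ i, a (i + 1) ≤ a i + 1 ∧ a i ≤ a (i + 1) + 1) :
    LineAdj a a := by
  intro i
  have hi := h i
  refine ⟨min (a i) (a (i + 1)), fun t h1 h2 => ?_⟩
  obtain rfl | rfl : t = i ∨ t = i + 1 := by omega
  all_goals omega

/-- The reflected face sphere `(i, j) ↦ f (i, height - j)`. (For `j > height` the truncated
subtraction gives a value on the boundary.) -/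
def inv (f : FaceSphere X x₀) : FaceSphere X x₀ :=
  ofSquareAdj f.width f.height (fun p => f.val (p.1, f.height - p.2))
    (f.squareAdj.comp (a := fun i => i) (a' := fun i => i) (b := fun j => f.height - j)
      (b' := fun j => f.height - j) (lineAdj_of_step fun i => by omega)
      (lineAdj_of_step fun i => by omega))
    (fun i j h => f.boundary _ _ (by omega))

theorem inv_equiv {f g : FaceSphere X x₀} (h : f ≈ g) : f.inv ≈ g.inv := by
  refine lift_equiv ?_ ?_ h
  · intro a a' ha
    obtain ⟨k1, k2, k3⟩ := isTrivialExtension_iff.1 ha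
    obtain ⟨r, hr⟩ := Nat.exists_eq_add_of_le k1
    obtain ⟨s, hs⟩ := Nat.exists_eq_add_of_le k2
    have e : a'.inv = a.inv.stretchBy a.width 0 r s := by
      ext ⟨i, j⟩
      · simp only [inv, stretchBy, ofSquareAdj]; omega
      · simp only [inv, stretchBy, ofSquareAdj]; omega
      · simp only [inv, stretchBy, ofSquareAdj, k3, hs]
        by_cases c : i ≤ a.width ∧ s ≤ j
        · congr 2 <;> simp only [stretch] <;> omega
        · rw [a.boundary, a.boundary] <;> (try simp only [stretch]) <;> omega
    rw [e]
    exact stretchBy_equiv _ _ _ _ _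
  · intro a b hab
    rw [contig_iff] at hab
    obtain ⟨h1, h2, h3⟩ := hab
    refine Contig.equiv (contig_iff.2 ⟨h1, h2, ?_⟩)
    simp only [inv, ofSquareAdj, h2]
    exact h3.comp (a := fun i => i) (a' := fun i => i) (b := fun j => a.height - j)
      (b' := fun j => a.height - j) (lineAdj_of_step fun i => by omega)
      (lineAdj_of_step fun i => by omega)

theorem inv_mul_equiv (f : FaceSphere X x₀) : f.inv.mul f ≈ const X x₀ 0 0 := by
  let G : ℕ → ℕ × ℕ → V := fun k p =>
    if p.2 ≤ f.height then f.val (p.1, f.height - p.2)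
    else f.val (stretch k (f.width + 1) p.1, p.2 - (f.height + 1))
  have hlow : ∀ k a b, b ≤ f.height + 1 → G k (a, b) = f.val (a, f.height - b) := by
    intro k a b hb
    simp only [G]
    split_ifs with h
    · rfl
    · rw [f.boundary _ _ (by omega), f.boundary _ _ (by omega)]
  have hid : LineAdj (fun i => i) (fun i => i) := lineAdj_of_step fun i => by omega
  have hG : ∀ k k', LineAdj (stretch k (f.width + 1)) (stretch k' (f.width + 1)) →
      SquareAdj X (G k) (G k') := by
    intro k k' hk i j
    by_cases hj : j ≤ f.height
    · obtain ⟨S, hS, hS'⟩ := f.squareAdj.comp hid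
        (b := fun j => f.height - j) (b' := fun j => f.height - j)
        (lineAdj_of_step fun i => by omega) i j
      refine ⟨S, hS, fun a b h1 h2 h3 h4 => ?_⟩
      rw [hlow k a b (by omega), hlow k' a b (by omega)]
      exact hS' a b h1 h2 h3 h4
    · obtain ⟨S, hS, hS'⟩ := f.squareAdj.comp hk
        (b := fun j => j - (f.height + 1)) (b' := fun j => j - (f.height + 1))
        (lineAdj_of_step fun i => by omega) i j
      refine ⟨S, hS, fun a b h1 h2 h3 h4 => ?_⟩
      simp only [G]
      rw [if_neg (by omega), if_neg (by omega)]
      exact hS' a b h1 h2 h3 h4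
  let A : ℕ → FaceSphere X x₀ := fun k =>
    ofSquareAdj (f.width + f.width + 1) (f.height + f.height + 1) (G k)
      (hG k k (lineAdj_stretch_self _ _)) (by
        intro i j hij
        simp only [G]
        split_ifs <;> refine f.boundary _ _ ?_ <;> (try simp only [stretch]) <;> omega)
  have hA0 : f.inv.mul f = A 0 := by
    ext ⟨i, j⟩
    · rfl
    · rfl
    · simp only [mul, inv, A, G, ofSquareAdj, mulVal]
      split_ifs with c1 c2 c3 c4
      · rfl
      · exfalso; omega
      · exfalso; omega
      · congr 2
        simp only [stretch]
        omega
      · exact (f.boundary _ _ (by omega)).symm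
      · exact (f.boundary _ _ (by simp only [stretch]; omega)).symm
  have hA : ∀ k, A 0 ≈ A k := by
    intro k
    induction k with
    | zero => exact Setoid.refl _
    | succ k ih =>
      exact Setoid.trans ih (Contig.equiv (contig_iff.2 ⟨rfl, rfl, hG _ _ (lineAdj_stretch _ _)⟩))
  let φ : ℕ → ℕ := fun j => if j ≤ f.height then f.height - j else j - (f.height + 1)
  have hφ : ∀ j, φ (j + 1) ≤ φ j + 1 ∧ φ j ≤ φ (j + 1) + 1 := by
    intro s
    simp only [φ]
    split_ifs <;> omega
  have hφ' : ∀ p, LineAdj (fun j => max (φ j) p) (fun j => max (φ j) (p + 1)) := by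
    intro p j
    have hj := hφ j
    refine ⟨min (max (φ j) p) (max (φ (j + 1)) p), fun t h1 h2 => ?_⟩
    obtain rfl | rfl : t = j ∨ t = j + 1 := by omega
    all_goals (dsimp only; omega)
  let B : ∀ p, p ≤ f.height → FaceSphere X x₀ := fun p hp =>
    ofSquareAdj (f.width + f.width + 1) (f.height + f.height + 1)
      (fun q => f.val (q.1, max (φ q.2) p)) (f.squareAdj.comp hid (hφ' p).left) (by
        intro i j hij
        refine f.boundary _ _ ?_
        simp only [φ]
        split_ifs <;> omega)
  have hAB : A f.width = B 0 (Nat.zero_le _) := by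
    ext ⟨i, j⟩
    · rfl
    · rfl
    · simp only [A, B, G, φ, ofSquareAdj, Nat.max_zero]
      split_ifs with c
      · rfl
      · by_cases hi : i ≤ f.width
        · congr 2
          simp only [stretch]
          omega
        · rw [f.boundary, f.boundary] <;> (try simp only [stretch]) <;> omega
  have hB : ∀ p (hp : p ≤ f.height), B 0 (Nat.zero_le _) ≈ B p hp := by
    intro p
    induction p with
    | zero => intro _; exact Setoid.refl _
    | succ p ih =>
      intro hp
      exact Setoid.trans (ih (by omega))
        (Contig.equiv (contig_iff.2 ⟨rfl, rfl, f.squareAdj.comp hid (hφ' p)⟩))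
  have hBc : B f.height le_rfl = const X x₀ (f.width + f.width + 1) (f.height + f.height + 1) := by
    ext ⟨i, j⟩
    · rfl
    · rfl
    · exact f.boundary _ _ (by simp)
  rw [hA0]
  refine Setoid.trans (hA f.width) ?_
  rw [hAB]
  refine Setoid.trans (hB f.height le_rfl) ?_
  rw [hBc]
  exact const_equiv _ _

end FaceSphere

/-- The face group `F(X, x₀)`: face spheres of all sizes modulo extension-contiguity
equivalence. -/
def FaceGroup (X : AbstractSimplicialComplex V) (x₀ : V) : Type u :=
  Quotient (FaceSphere.setoid X x₀)

/-- The class of a face sphere in the face group. -/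
def FaceSphere.toFaceGroup (f : FaceSphere X x₀) : FaceGroup X x₀ :=
  Quotient.mk (FaceSphere.setoid X x₀) f

namespace FaceGroup

instance : One (FaceGroup X x₀) := ⟨(FaceSphere.const X x₀ 0 0).toFaceGroup⟩

instance : Mul (FaceGroup X x₀) :=
  ⟨Quotient.map₂ FaceSphere.mul (fun _ _ hf _ _ hg => FaceSphere.mul_equiv hf hg)⟩

instance : Inv (FaceGroup X x₀) := ⟨Quotient.map FaceSphere.inv (fun _ _ h => FaceSphere.inv_equiv h)⟩

/-- The group structure of the face group: the product is induced by the block-diagonal product of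
face spheres, the unit is the class of the constant map. -/
instance : Group (FaceGroup X x₀) :=
  Group.ofLeftAxioms
    (by
      rintro ⟨f⟩ ⟨g⟩ ⟨h⟩
      exact congrArg FaceSphere.toFaceGroup (FaceSphere.mul_assoc' f g h))
    (by
      rintro ⟨f⟩
      exact Quotient.sound (FaceSphere.const_mul_equiv f))
    (by
      rintro ⟨f⟩
      exact Quotient.sound (FaceSphere.inv_mul_equiv f))

end FaceGroup

/-! ### The map from face spheres to edge loops in `ΩX` -/

namespace FaceSphere

/-- The `j`th row `s ↦ f (s, j)` of a face sphere of size `m × n`, an edge loop of length `m`. -/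
def row (f : FaceSphere X x₀) (j : ℕ) : EdgeLoop X x₀ where
  len := f.width
  vert s := f.val (s, j)
  start := f.boundary _ _ (Or.inl rfl)
  finish i hi := f.boundary _ _ (Or.inr (Or.inl hi))
  edge i _ := by
    obtain ⟨S, hS, hS'⟩ := f.squareAdj i j
    refine hS.mono ?_ (by simp)
    rintro v (rfl | rfl)
    · exact (hS' i j le_rfl (by omega) le_rfl (by omega)).1
    · exact (hS' (i + 1) j (by omega) le_rfl le_rfl (by omega)).1

/-- The `t`th vertex of the edge loop `Φ(f)` in `ΩX`, for `f` of size `m × n`: the constant loop of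
length `t` for `t ≤ m`; the rows of `f` for `m ≤ t ≤ m + n` (row `0` and row `n` being the constant
loop of length `m`); the constant loop of length `2m + n - t` afterwards. -/
def phiVert (f : FaceSphere X x₀) (t : ℕ) : EdgeLoop X x₀ :=
  if t ≤ f.width then EdgeLoop.const X x₀ t
  else if t ≤ f.width + f.height then f.row (t - f.width)
  else EdgeLoop.const X x₀ (2 * f.width + f.height - t)

theorem isSimplex_const_pair (a b : ℕ) (hab : b = a ∨ b = a + 1 ∨ a = b + 1) :
    IsSimplex (loopComplex X x₀) {EdgeLoop.const X x₀ a, EdgeLoop.const X x₀ b} := by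
  classical
  refine ⟨{EdgeLoop.const X x₀ a, EdgeLoop.const X x₀ b}, ⟨max a b, ?_, ?_, ?_⟩, by simp⟩
  · rcases le_total a b with h | h
    · exact ⟨EdgeLoop.const X x₀ b, by simp, by simp [EdgeLoop.const, h]⟩
    · exact ⟨EdgeLoop.const X x₀ a, by simp, by simp [EdgeLoop.const, h]⟩
  · intro l hl
    simp only [Finset.mem_insert, Finset.mem_singleton] at hl
    rcases hl with rfl | rfl <;> simp only [EdgeLoop.const] <;> omega
  · intro i _
    refine (isSimplex_singleton X x₀).mono ?_ ?_
    · rintro v (⟨l, hl, rfl⟩ | ⟨l, hl, rfl⟩) <;>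
      · simp only [Finset.coe_insert, Finset.coe_singleton, Set.mem_insert_iff,
          Set.mem_singleton_iff] at hl
        rcases hl with rfl | rfl <;> simp [EdgeLoop.const]
    · exact ⟨_, Or.inl ⟨EdgeLoop.const X x₀ a, by simp, rfl⟩⟩

theorem isSimplex_row_pair (f : FaceSphere X x₀) (j : ℕ) :
    IsSimplex (loopComplex X x₀) {f.row j, f.row (j + 1)} := by
  classical
  refine ⟨{f.row j, f.row (j + 1)}, ⟨f.width, ⟨f.row j, by simp, rfl⟩, ?_, ?_⟩, by simp⟩
  · intro l hl
    simp only [Finset.mem_insert, Finset.mem_singleton] at hl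
    rcases hl with rfl | rfl <;> exact Or.inl rfl
  · intro i _
    obtain ⟨S, hS, hS'⟩ := f.squareAdj i j
    refine hS.mono ?_ ⟨_, Or.inl ⟨f.row j, by simp, rfl⟩⟩
    rintro v (⟨l, hl, rfl⟩ | ⟨l, hl, rfl⟩) <;>
    · simp only [Finset.coe_insert, Finset.coe_singleton, Set.mem_insert_iff,
        Set.mem_singleton_iff] at hl
      rcases hl with rfl | rfl
      · exact (hS' _ _ (by omega) (by omega) (by omega) (by omega)).1
      · exact (hS' _ _ (by omega) (by omega) (by omega) (by omega)).1

theorem row_eq_const (f : FaceSphere X x₀) (j : ℕ) (hj : j = 0 ∨ f.height ≤ j) :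
    f.row j = EdgeLoop.const X x₀ f.width := by
  ext s
  · rfl
  · exact f.boundary _ _ (by omega)

/-- The edge loop `Φ(f) = (x₀, x₀^1, …, x₀^m, l^1, …, l^{n-1}, x₀^m, …, x₀^1, x₀)` in `ΩX`, of
length `2m + n`, where `f` is a face sphere of size `m × n` with rows `l^0, …, l^n`. -/
def phi (f : FaceSphere X x₀) : EdgeLoop (loopComplex X x₀) (loopBase X x₀) where
  len := 2 * f.width + f.height
  vert := f.phiVert
  start := by simp [phiVert, loopBase]
  finish t ht := by
    simp only [phiVert]
    split_ifs with h1 h2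
    · rw [show t = 0 by omega]; rfl
    · rw [row_eq_const _ _ (by omega), show f.width = 0 by omega]; rfl
    · rw [Nat.sub_eq_zero_of_le ht]; rfl
  edge t ht := by
    rcases Nat.lt_or_ge t f.width with h1 | h1
    · simp only [phiVert]
      rw [if_pos h1.le, if_pos (by omega)]
      exact isSimplex_const_pair _ _ (by omega)
    rcases Nat.lt_or_ge t (f.width + f.height) with h2 | h2
    · have e1 : f.phiVert t = f.row (t - f.width) := by
        simp only [phiVert]
        split_ifs with c
        · rw [row_eq_const _ _ (by omega), show t = f.width by omega]
        · rfl
        · omega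
      have e2 : f.phiVert (t + 1) = f.row (t - f.width + 1) := by
        simp only [phiVert]
        rw [if_neg (by omega), if_pos (by omega)]
        congr 1
        omega
      rw [e1, e2]
      exact f.isSimplex_row_pair _
    · have e1 : f.phiVert t = EdgeLoop.const X x₀ (2 * f.width + f.height - t) := by
        simp only [phiVert]
        split_ifs with c1 c2
        · congr 1; omega
        · rw [row_eq_const _ _ (by omega)]; congr 1; omega
        · rfl
      have e2 : f.phiVert (t + 1) = EdgeLoop.const X x₀ (2 * f.width + f.height - (t + 1)) := by
        simp only [phiVert]
        rw [if_neg (by omega), if_neg (by omega)]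
      rw [e1, e2]
      exact isSimplex_const_pair _ _ (by omega)

end FaceSphere

end SimplicialLoop

namespace SimplicialLoop

universe u

variable {V : Type u} {X : AbstractSimplicialComplex V} {x₀ : V}

/-- A set of loops is a simplex of `ΩX` when the lengths differ by at most one and consecutive
vertices of all members lie in a common simplex of `X`. -/
theorem isSimplex_loopComplex_iff {T : Set (EdgeLoop X x₀)} :
    IsSimplex (loopComplex X x₀) T ↔ T.Finite ∧ T.Nonempty ∧
      (∃ c, ∀ l ∈ T, c ≤ l.len ∧ l.len ≤ c + 1) ∧
      ∀ i, ∃ S, IsSimplex X S ∧ ∀ l ∈ T, l.vert i ∈ S ∧ l.vert (i + 1) ∈ S := by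
  constructor
  · rintro ⟨σ, ⟨m, ⟨l₀, hl₀, hm⟩, hlen, hs⟩, rfl⟩
    refine ⟨σ.finite_toSet, ⟨l₀, hl₀⟩, ⟨m - 1, fun l hl => ?_⟩, fun i => ?_⟩
    · have := hlen l hl
      omega
    · by_cases hi : i < m
      · exact ⟨_, hs i hi, fun l hl => ⟨Or.inl ⟨l, hl, rfl⟩, Or.inr ⟨l, hl, rfl⟩⟩⟩
      · refine ⟨{x₀}, isSimplex_singleton X x₀, fun l hl => ?_⟩
        have := hlen l hl
        exact ⟨l.finish _ (by omega), l.finish _ (by omega)⟩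
  · rintro ⟨hfin, ⟨l₀, hl₀⟩, ⟨c, hc⟩, hs⟩
    refine ⟨hfin.toFinset, ?_, by simp⟩
    have hsub : ∀ i, IsSimplex X
        ((fun l : EdgeLoop X x₀ => l.vert i) '' hfin.toFinset ∪
          (fun l : EdgeLoop X x₀ => l.vert (i + 1)) '' hfin.toFinset) := by
      intro i
      obtain ⟨S, hS, hS'⟩ := hs i
      refine hS.mono ?_ ⟨_, Or.inl ⟨l₀, by simpa using hl₀, rfl⟩⟩
      rintro v (⟨l, hl, rfl⟩ | ⟨l, hl, rfl⟩)
      · exact (hS' l (by simpa using hl)).1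
      · exact (hS' l (by simpa using hl)).2
    by_cases h : ∃ l ∈ T, l.len = c + 1
    · obtain ⟨l, hl, hlc⟩ := h
      refine ⟨c + 1, ⟨l, by simpa using hl, hlc⟩, fun k hk => ?_, fun i _ => hsub i⟩
      have := hc k (by simpa using hk)
      omega
    · push Not at h
      have hlen : ∀ l ∈ T, l.len = c := fun l hl => by
        have := hc l hl
        have := h l hl
        omega
      exact ⟨c, ⟨l₀, by simpa using hl₀, hlen _ hl₀⟩,
        fun l hl => Or.inl (hlen l (by simpa using hl)), fun i _ => hsub i⟩

namespace EdgeLoop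

/-- The loop that waits at the basepoint for `r` steps before and `s` steps after `l`. -/
def shift (l : EdgeLoop X x₀) (r s : ℕ) : EdgeLoop X x₀ where
  len := l.len + r + s
  vert t := l.vert (t - r)
  start := by simp [l.start]
  finish t ht := l.finish _ (by omega)
  edge t _ := by
    by_cases h : t < r
    · rw [Nat.sub_eq_zero_of_le h.le, Nat.sub_eq_zero_of_le h, l.start]
      simpa using isSimplex_singleton X x₀
    · rw [Nat.sub_add_comm (by omega)]
      exact l.edge' _

theorem shift_toEdgeGroup (l : EdgeLoop X x₀) (r s : ℕ) :
    (l.shift r s).toEdgeGroup = l.toEdgeGroup := by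
  induction r with
  | zero =>
    induction s with
    | zero => rfl
    | succ s ih =>
      have e : l.shift 0 (s + 1) = (l.shift 0 s).repeatVertex (l.shift 0 s).len le_rfl := by
        ext t
        · rfl
        · change l.vert t = if t ≤ l.len + 0 + s then l.vert t else l.vert (t - 1)
          by_cases h : t ≤ l.len + 0 + s
          · rw [if_pos h]
          · rw [if_neg h, l.finish _ (by omega), l.finish _ (by omega)]
      rw [← ih, e]
      exact (Quot.sound (.extend _ _ _)).symm
  | succ r ih =>
    have e : l.shift (r + 1) s = (l.shift r s).repeatVertex 0 (Nat.zero_le _) := by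
      ext t
      · simp only [shift, repeatVertex]; omega
      · simp only [shift, repeatVertex]
        split_ifs <;> congr 1 <;> omega
    rw [← ih, e]
    exact (Quot.sound (.extend _ _ _)).symm

/-- The extension of a loop to length at least `k` by repeating its final vertex. -/
def padTo (l : EdgeLoop X x₀) (k : ℕ) : EdgeLoop X x₀ where
  len := max l.len k
  vert := l.vert
  start := l.start
  finish i hi := l.finish i (by omega)
  edge i _ := l.edge' i

theorem isSimplex_padTo {l k : EdgeLoop X x₀} (h : IsSimplex (loopComplex X x₀) {l, k})
    {p p' q q' c : ℕ} (hp : c ≤ p ∧ p ≤ c + 1) (hp' : c ≤ p' ∧ p' ≤ c + 1)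
    (hq : c ≤ q ∧ q ≤ c + 1) (hq' : c ≤ q' ∧ q' ≤ c + 1) :
    IsSimplex (loopComplex X x₀) {l.padTo p, k.padTo q, l.padTo p', k.padTo q'} := by
  obtain ⟨-, -, ⟨d, hd⟩, hs⟩ := isSimplex_loopComplex_iff.1 h
  have hl := hd l (by simp)
  have hk := hd k (by simp)
  refine isSimplex_loopComplex_iff.2 ⟨by simp, by simp, ⟨max c d, ?_⟩, fun i => ?_⟩
  · rintro a (rfl | rfl | rfl | rfl) <;> simp only [padTo] <;> omega
  · obtain ⟨S, hS, hS'⟩ := hs i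
    refine ⟨S, hS, ?_⟩
    rintro a (rfl | rfl | rfl | rfl)
    exacts [hS' l (by simp), hS' k (by simp), hS' l (by simp), hS' k (by simp)]

/-- The edge loop in `ΩX` whose `t`th vertex is that of `L`, extended to length at least `h t`. -/
def lengthen (L : EdgeLoop (loopComplex X x₀) (loopBase X x₀)) (h : ℕ → ℕ)
    (hstep : ∀ t, h (t + 1) ≤ h t + 1 ∧ h t ≤ h (t + 1) + 1) (hstart : h 0 = 0)
    (hfinish : ∀ t, L.len ≤ t → h t = 0) :
    EdgeLoop (loopComplex X x₀) (loopBase X x₀) where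
  len := L.len
  vert t := (L.vert t).padTo (h t)
  start := by rw [hstart, L.start]; rfl
  finish t ht := by rw [hfinish t ht, L.finish t ht]; rfl
  edge t _ := by
    have := hstep t
    have hc : min (h t) (h (t + 1)) ≤ h t ∧ h t ≤ min (h t) (h (t + 1)) + 1 := by omega
    have hc' : min (h t) (h (t + 1)) ≤ h (t + 1) ∧ h (t + 1) ≤ min (h t) (h (t + 1)) + 1 := by omega
    exact (isSimplex_padTo (L.edge' t) hc hc hc' hc').mono (by grind) (by simp)

theorem lengthen_toEdgeGroup (L : EdgeLoop (loopComplex X x₀) (loopBase X x₀)) (h : ℕ → ℕ)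
    (hstep : ∀ t, h (t + 1) ≤ h t + 1 ∧ h t ≤ h (t + 1) + 1) (hstart : h 0 = 0)
    (hfinish : ∀ t, L.len ≤ t → h t = 0) :
    (L.lengthen h hstep hstart hfinish).toEdgeGroup = L.toEdgeGroup := by
  have hle : ∀ t, h t ≤ t := by
    intro t
    induction t with
    | zero => exact hstart.le
    | succ t ih => have := hstep t; omega
  let c : ℕ → EdgeLoop (loopComplex X x₀) (loopBase X x₀) := fun p =>
    L.lengthen (fun t => min p (h t)) (fun t => by have := hstep t; omega)
      (by simp [hstart]) (fun t ht => by simp [hfinish t ht])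
  have h0 : c 0 = L := by
    ext t
    · rfl
    · simp [c, lengthen, padTo]
    · rfl
  have h1 : c L.len = L.lengthen h hstep hstart hfinish := by
    ext t
    · rfl
    · have : min L.len (h t) = h t := by
        by_cases ht : L.len ≤ t
        · simp [hfinish t ht]
        · have := hle t
          omega
      simp only [c, lengthen, this]
    · rfl
  have step : ∀ p, (c 0).toEdgeGroup = (c p).toEdgeGroup := by
    intro p
    induction p with
    | zero => rfl
    | succ p ih =>
      rw [ih]
      refine toEdgeGroup_eq_of_contiguous _ _ rfl fun t _ => ?_
      have := hstep t
      exact isSimplex_padTo (c := min (min p (h t)) (min p (h (t + 1)))) (L.edge' t)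
        (by dsimp only; omega) (by dsimp only; omega) (by dsimp only; omega) (by dsimp only; omega)
  rw [← h1, ← step, h0]

theorem len_vert_le (L : EdgeLoop (loopComplex X x₀) (loopBase X x₀)) (t : ℕ) :
    (L.vert t).len ≤ t := by
  induction t with
  | zero => rw [L.start]; rfl
  | succ t ih =>
    obtain ⟨-, -, ⟨d, hd⟩, -⟩ := isSimplex_loopComplex_iff.1 (L.edge' t)
    have h1 := hd (L.vert t) (by simp)
    have h2 := hd (L.vert (t + 1)) (by simp)
    omega

theorem len_vert_le_len (L : EdgeLoop (loopComplex X x₀) (loopBase X x₀)) (t : ℕ) :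
    (L.vert t).len ≤ L.len := by
  by_cases h : t ≤ L.len
  · exact (L.len_vert_le t).trans h
  · rw [L.finish t (by omega)]
    exact Nat.zero_le _

/-- The face sphere whose rows are the vertices of an edge loop in `ΩX`, all extended to the
length of that edge loop. -/
def toFaceSphere (L : EdgeLoop (loopComplex X x₀) (loopBase X x₀)) : FaceSphere X x₀ :=
  FaceSphere.ofSquareAdj L.len L.len (fun p => (L.vert p.2).vert p.1)
    (by
      intro i j
      obtain ⟨-, -, -, hs⟩ := isSimplex_loopComplex_iff.1 (L.edge' j)
      obtain ⟨S, hS, hS'⟩ := hs i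
      refine ⟨S, hS, fun a b h1 h2 h3 h4 => ?_⟩
      have ha : a = i ∨ a = i + 1 := by omega
      have hb : b = j ∨ b = j + 1 := by omega
      have k1 := hS' (L.vert j) (by simp)
      have k2 := hS' (L.vert (j + 1)) (by simp)
      rcases ha with rfl | rfl <;> rcases hb with rfl | rfl <;> simp [k1, k2])
    (by
      rintro i j (rfl | h | rfl | h)
      · exact (L.vert j).start
      · exact (L.vert j).finish _ ((L.len_vert_le_len j).trans h)
      · change (L.vert 0).vert i = x₀
        rw [L.start]
        rfl
      · change (L.vert j).vert i = x₀
        rw [L.finish j h]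
        rfl)

theorem toFaceSphere_move {L K : EdgeLoop (loopComplex X x₀) (loopBase X x₀)} (h : Move L K) :
    L.toFaceSphere ≈ K.toFaceSphere := by
  cases h with
  | extend j hj =>
    have e : (L.repeatVertex j hj).toFaceSphere = L.toFaceSphere.stretchBy L.len j 1 1 := by
      ext ⟨a, b⟩
      · rfl
      · rfl
      · have h1 : (L.repeatVertex j hj).vert b = L.vert (stretch j 1 b) := by
          simp only [repeatVertex]
          split_ifs <;> congr 1 <;> simp only [stretch] <;> omega
        change ((L.repeatVertex j hj).vert b).vert a
          = (L.vert (stretch j 1 b)).vert (stretch L.len 1 a)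
        rw [h1]
        by_cases ha : a ≤ L.len
        · congr 1
          simp only [stretch]
          omega
        · have := L.len_vert_le_len (stretch j 1 b)
          rw [finish _ _ (by omega), finish]
          simp only [stretch] at this ⊢
          omega
    rw [e]
    exact FaceSphere.stretchBy_equiv _ _ _ _ _
  | replace _ j hlen h0 hj hne hl hr =>
    refine FaceSphere.Contig.equiv (FaceSphere.contig_iff.2 ⟨hlen, hlen, fun i t => ?_⟩)
    have key : ∃ T, IsSimplex (loopComplex X x₀) T ∧ L.vert t ∈ T ∧ L.vert (t + 1) ∈ T ∧
        K.vert t ∈ T ∧ K.vert (t + 1) ∈ T := by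
      by_cases h1 : t = j
      · subst h1
        exact ⟨_, hr, by simp [hne (t + 1)]⟩
      by_cases h2 : t + 1 = j
      · subst h2
        exact ⟨_, hl, by simp [hne t]⟩
      · exact ⟨_, L.edge' t, by simp [hne t h1, hne (t + 1) h2]⟩
    obtain ⟨T, hT, t1, t2, t3, t4⟩ := key
    obtain ⟨-, -, -, hs⟩ := isSimplex_loopComplex_iff.1 hT
    obtain ⟨S, hS, hS'⟩ := hs i
    refine ⟨S, hS, fun a b c1 c2 c3 c4 => ?_⟩
    have ha : a = i ∨ a = i + 1 := by omega
    have hb : b = t ∨ b = t + 1 := by omega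
    have k1 := hS' _ t1
    have k2 := hS' _ t2
    have k3 := hS' _ t3
    have k4 := hS' _ t4
    rcases ha with rfl | rfl <;> rcases hb with rfl | rfl <;>
      simp [toFaceSphere, FaceSphere.ofSquareAdj, k1, k2, k3, k4]

end EdgeLoop

namespace FaceSphere

theorem phi_vert_len (f : FaceSphere X x₀) (t : ℕ) :
    (f.phi.vert t).len = min (min t f.width) (2 * f.width + f.height - t) := by
  simp only [phi, phiVert]
  split_ifs <;> simp only [EdgeLoop.const, row] <;> omega

theorem phi_vert_vert (f : FaceSphere X x₀) (t i : ℕ) :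
    (f.phi.vert t).vert i = f.val (i, t - f.width) := by
  simp only [phi, phiVert]
  split_ifs
  · exact (f.boundary _ _ (by omega)).symm
  · rfl
  · exact (f.boundary _ _ (by omega)).symm

theorem phi_contig {f g : FaceSphere X x₀} (h : f.Contig g) :
    f.phi.toEdgeGroup = g.phi.toEdgeGroup := by
  obtain ⟨h1, h2, h3⟩ := contig_iff.1 h
  refine EdgeLoop.toEdgeGroup_eq_of_contiguous _ _ (by simp [phi, h1, h2]) fun t ht => ?_
  have hlen : f.phi.len = 2 * f.width + f.height := rfl
  refine isSimplex_loopComplex_iff.2 ⟨by simp, by simp,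
    ⟨min (min t f.width) (2 * f.width + f.height - (t + 1)), ?_⟩, fun i => ?_⟩
  · rintro l (rfl | rfl | rfl | rfl) <;> simp only [phi_vert_len, h1, h2] <;> omega
  · obtain ⟨S, hS, hS'⟩ := h3 i (t - f.width)
    refine ⟨S, hS, ?_⟩
    rintro l (rfl | rfl | rfl | rfl) <;> simp only [phi_vert_vert, h1]
    · exact ⟨(hS' _ _ (by omega) (by omega) (by omega) (by omega)).1,
        (hS' _ _ (by omega) (by omega) (by omega) (by omega)).1⟩
    · exact ⟨(hS' _ _ (by omega) (by omega) (by omega) (by omega)).1,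
        (hS' _ _ (by omega) (by omega) (by omega) (by omega)).1⟩
    · exact ⟨(hS' _ _ (by omega) (by omega) (by omega) (by omega)).2,
        (hS' _ _ (by omega) (by omega) (by omega) (by omega)).2⟩
    · exact ⟨(hS' _ _ (by omega) (by omega) (by omega) (by omega)).2,
        (hS' _ _ (by omega) (by omega) (by omega) (by omega)).2⟩

theorem phi_trivialExtension {f f' : FaceSphere X x₀} (h : f.IsTrivialExtension f') :
    f.phi.toEdgeGroup = f'.phi.toEdgeGroup := by
  obtain ⟨h1, h2, h3⟩ := isTrivialExtension_iff.1 h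
  obtain ⟨r, hr⟩ := Nat.exists_eq_add_of_le h1
  obtain ⟨s, hs⟩ := Nat.exists_eq_add_of_le h2
  have hlen : (f.phi.shift r (r + s)).len = 2 * f'.width + f'.height := by
    simp only [EdgeLoop.shift, phi]
    omega
  rw [← f.phi.shift_toEdgeGroup r (r + s),
    ← (f.phi.shift r (r + s)).lengthen_toEdgeGroup
      (fun t => min (min t f'.width) (2 * f'.width + f'.height - t))
      (fun t => by omega) (by simp) (fun t ht => by omega)]
  congr 1
  refine EdgeLoop.ext hlen (funext fun t => ?_)
  ext i
  · change max (f.phi.vert (t - r)).len _ = _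
    simp only [phi_vert_len]
    omega
  · change (f.phi.vert (t - r)).vert i = _
    rw [phi_vert_vert, phi_vert_vert, h3, hr, Nat.sub_sub, Nat.add_comm r]

theorem phi_equiv {f g : FaceSphere X x₀} (h : f ≈ g) : f.phi.toEdgeGroup = g.phi.toEdgeGroup := by
  obtain ⟨f', g', hf, hg, h⟩ := h
  rw [phi_trivialExtension hf, phi_trivialExtension hg]
  clear hf hg
  induction h with
  | refl => rfl
  | tail _ h ih => exact ih.trans (phi_contig h)

theorem toFaceSphere_phi_equiv (f : FaceSphere X x₀) : f.phi.toFaceSphere ≈ f := by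
  refine Setoid.symm (Setoid.trans (stretchBy_equiv f 0 0 0 f.width)
    (IsTrivialExtension.equiv (isTrivialExtension_iff.2 ⟨?_, ?_, ?_⟩)))
  · change f.width + 0 ≤ 2 * f.width + f.height
    omega
  · change f.height + f.width ≤ 2 * f.width + f.height
    omega
  · funext ⟨i, t⟩
    change (f.phi.vert t).vert i = f.val (stretch 0 0 i, stretch 0 f.width t)
    rw [phi_vert_vert]
    congr 2 <;> simp only [stretch] <;> omega

theorem phi_toFaceSphere (L : EdgeLoop (loopComplex X x₀) (loopBase X x₀)) :
    L.toFaceSphere.phi.toEdgeGroup = L.toEdgeGroup := by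
  rw [← L.shift_toEdgeGroup L.len L.len, ← (L.shift L.len L.len).lengthen_toEdgeGroup
      (fun t => min (min t L.len) (2 * L.len + L.len - t))
      (fun t => by omega) (by simp)
      (fun t ht => by simp only [EdgeLoop.shift] at ht; omega)]
  congr 1
  refine EdgeLoop.ext ?_ (funext fun t => ?_)
  · change 2 * L.len + L.len = L.len + L.len + L.len
    omega
  · ext i
    · rw [phi_vert_len]
      change min (min t L.len) (2 * L.len + L.len - t) = max (L.vert (t - L.len)).len _
      have h1 := L.len_vert_le (t - L.len)
      have h2 := L.len_vert_le_len (t - L.len)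
      have h3 : L.len ≤ t - L.len → (L.vert (t - L.len)).len = 0 := fun h => by
        rw [L.finish _ h]; rfl
      dsimp only
      omega
    · rw [phi_vert_vert]
      rfl

/-- The face sphere that places `g` above `f`, both starting at the left edge. -/
def stack (f g : FaceSphere X x₀) : FaceSphere X x₀ :=
  ofSquareAdj (f.width + g.width + 1) (f.height + g.height + 1)
    (fun p => if p.2 ≤ f.height then f.val p else g.val (p.1, p.2 - (f.height + 1)))
    (by
      intro i j
      by_cases hj : j ≤ f.height
      · obtain ⟨S, hS, hS'⟩ := f.squareAdj i j
        refine ⟨S, hS, fun a b h1 h2 h3 h4 => ?_⟩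
        have e : (if b ≤ f.height then f.val (a, b) else g.val (a, b - (f.height + 1)))
            = f.val (a, b) := by
          split_ifs
          · rfl
          · rw [f.boundary _ _ (by omega), g.boundary _ _ (by omega)]
        simp only [e]
        exact hS' a b h1 h2 h3 h4
      · obtain ⟨S, hS, hS'⟩ := g.squareAdj i (j - (f.height + 1))
        refine ⟨S, hS, fun a b h1 h2 h3 h4 => ?_⟩
        simp only [if_neg (show ¬ b ≤ f.height by omega)]
        exact hS' _ _ h1 h2 (by omega) (by omega))
    (by
      intro i j hij
      dsimp only
      split_ifs
      · exact f.boundary _ _ (by omega)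
      · exact g.boundary _ _ (by omega))

theorem mul_equiv_stack (f g : FaceSphere X x₀) : f.mul g ≈ f.stack g := by
  let G : ℕ → ℕ × ℕ → V := fun k p =>
    if p.2 ≤ f.height then f.val p
    else g.val (stretch k (f.width + 1) p.1, p.2 - (f.height + 1))
  have hlow : ∀ k a b, b ≤ f.height + 1 → G k (a, b) = f.val (a, b) := by
    intro k a b hb
    simp only [G]
    split_ifs with h
    · rfl
    · rw [f.boundary _ _ (by omega), g.boundary _ _ (by omega)]
  have hG : ∀ k k', LineAdj (stretch k (f.width + 1)) (stretch k' (f.width + 1)) →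
      SquareAdj X (G k) (G k') := by
    intro k k' hk i j
    by_cases hj : j ≤ f.height
    · obtain ⟨S, hS, hS'⟩ := f.squareAdj i j
      refine ⟨S, hS, fun a b h1 h2 h3 h4 => ?_⟩
      rw [hlow k a b (by omega), hlow k' a b (by omega)]
      exact hS' a b h1 h2 h3 h4
    · obtain ⟨S, hS, hS'⟩ := g.squareAdj.comp hk
        (b := fun j => j - (f.height + 1)) (b' := fun j => j - (f.height + 1))
        (lineAdj_of_step fun i => by omega) i j
      refine ⟨S, hS, fun a b h1 h2 h3 h4 => ?_⟩
      simp only [G, if_neg (show ¬ b ≤ f.height by omega)]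
      exact hS' a b h1 h2 h3 h4
  let A : ℕ → FaceSphere X x₀ := fun k =>
    ofSquareAdj (f.width + g.width + 1) (f.height + g.height + 1) (G k)
      (hG k k (lineAdj_stretch_self _ _)) (by
        intro i j hij
        simp only [G]
        split_ifs
        · exact f.boundary _ _ (by omega)
        · exact g.boundary _ _ (by simp only [stretch]; omega))
  have hA0 : f.mul g = A 0 := by
    ext ⟨i, j⟩
    · rfl
    · rfl
    · simp only [mul, A, G, ofSquareAdj, mulVal]
      split_ifs with c1 c2 c3 c4
      · rfl
      · exfalso; omega
      · exfalso; omega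
      · congr 2
        simp only [stretch]
        omega
      · exact (f.boundary _ _ (by omega)).symm
      · exact (g.boundary _ _ (by simp only [stretch]; omega)).symm
  have hA : ∀ k, A 0 ≈ A k := by
    intro k
    induction k with
    | zero => exact Setoid.refl _
    | succ k ih =>
      exact Setoid.trans ih (Contig.equiv (contig_iff.2 ⟨rfl, rfl, hG _ _ (lineAdj_stretch _ _)⟩))
  have hA1 : A g.width = f.stack g := by
    ext ⟨i, j⟩
    · rfl
    · rfl
    · simp only [stack, A, G, ofSquareAdj]
      split_ifs
      · rfl
      · by_cases hi : i ≤ g.width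
        · congr 2
          simp only [stretch]
          omega
        · rw [g.boundary _ _ (by simp only [stretch]; omega), g.boundary _ _ (by omega)]
  rw [hA0, ← hA1]
  exact hA _

theorem toFaceSphere_concat_equiv (L K : EdgeLoop (loopComplex X x₀) (loopBase X x₀)) :
    (L.concat K).toFaceSphere ≈ L.toFaceSphere.mul K.toFaceSphere := by
  have e : (L.concat K).toFaceSphere = L.toFaceSphere.stack K.toFaceSphere := by
    ext ⟨i, j⟩
    · rfl
    · rfl
    · exact apply_ite (fun l : EdgeLoop X x₀ => l.vert i) _ _ _
  rw [e]
  exact Setoid.symm (mul_equiv_stack _ _)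

end FaceSphere

/-- The homomorphism from the edge group of `ΩX` to the face group of `X` induced by
`EdgeLoop.toFaceSphere`, an isomorphism whose inverse is induced by `FaceSphere.phi`. -/
def edgeGroupEquivFaceGroup (X : AbstractSimplicialComplex V) (x₀ : V) :
    EdgeGroup (loopComplex X x₀) (loopBase X x₀) ≃* FaceGroup X x₀ where
  toFun := Quot.lift (fun L => L.toFaceSphere.toFaceGroup)
    (fun _ _ h => Quotient.sound (EdgeLoop.toFaceSphere_move h))
  invFun := Quotient.lift (fun f => f.phi.toEdgeGroup) (fun _ _ h => FaceSphere.phi_equiv h)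
  left_inv := by
    rintro ⟨L⟩
    exact FaceSphere.phi_toFaceSphere L
  right_inv := by
    rintro ⟨f⟩
    exact Quotient.sound (FaceSphere.toFaceSphere_phi_equiv f)
  map_mul' := by
    rintro ⟨L⟩ ⟨K⟩
    exact Quotient.sound (FaceSphere.toFaceSphere_concat_equiv L K)

end SimplicialLoop

/-- For every based simplicial complex `(X, x₀)`, `[f] ↦ [Φ(f)]` is a well-defined isomorphism of
groups `F(X, x₀) ≃ E(ΩX, (x₀))`. -/
theorem mainTheorem1 {V : Type*} (X : AbstractSimplicialComplex V) (x₀ : V) :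
    ∃ e : SimplicialLoop.FaceGroup X x₀ ≃*
        SimplicialLoop.EdgeGroup (SimplicialLoop.loopComplex X x₀) (SimplicialLoop.loopBase X x₀),
      ∀ f : SimplicialLoop.FaceSphere X x₀, e f.toFaceGroup = f.phi.toEdgeGroup :=
  ⟨(SimplicialLoop.edgeGroupEquivFaceGroup X x₀).symm, fun _ => rfl⟩
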